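/- Let $\ell\ge 0$, $n_1,\dots,n_\ell\ge 0$ and $P\ge 1$ be integers and put $N=2\sum_{i=1}^{\ell}n_i+2+P$. Let $\mu_1,\dots,\mu_\ell\in\mathbb{C}^\times$ satisfy $\mu_i\neq\mu_j^{\pm1}$ for $i<j$ and $\mu_i^2\neq 1$ for all $i$. Let $SO(N)$ be the complex special orthogonal group of the symmetric bilinear form on $\mathbb{C}^N$ whose Gram matrix has ones on the antidiagonal and zeros elsewhere, and let $\mathbb{C}[SO(N)]$ be its coordinate ring, that is, the polynomial ring in the matrix entries $A_{ij}$ modulo the ideal of polynomials vanishing on $SO(N)$. Let $O$ be the conjugacy class in $SO(N)$ of the diagonal matrix $o\in SO(N)$ with diagonal entries $$\underbrace{\mu_1,\ldots,\mu_1}_{n_1},\ldots,\underbrace{\mu_\ell,\ldots,\mu_\ell}_{n_\ell},-1,\underbrace{1,\ldots,1}_{P},-1,\underbrace{\mu_\ell^{-1},\ldots,\mu_\ell^{-1}}_{n_\ell},\ldots,\underbrace{\mu_1^{-1},\ldots,\mu_1^{-1}}_{n_1}.$$ Consider, for the matrix $A=(A_{ij})$ of coordinate functions, the equations $$(A-\mu_1)\cdots(A-\mu_\ell)(A+1)(A-1)(A-\mu_\ell^{-1})\cdots(A-\mu_1^{-1})=0,$$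 $$\mathrm{Tr}(A^k)=\sum_{i=1}^{\ell}n_i(\mu_i^k+\mu_i^{-k})+2(-1)^k+P,\qquad k=1,\dots,N.$$ Then these equations generate the defining ideal of $O$ in $\mathbb{C}[SO(N)]$: the ideal of $\mathbb{C}[SO(N)]$ generated by the $N^2$ entries of the left-hand side of the first equation and by the $N$ differences of the two sides of the trace equations is equal to the ideal of all functions in $\mathbb{C}[SO(N)]$ that vanish on $O$ (in particular it is a radical ideal), and its set of common zeros in $SO(N)$ is exactly $O$. -/

import Mathlib

namespace BorderlineSO

/-- The Gram matrix of the split symmetric bilinear form on `ℂ^N`: ones on the antidiagonal. -/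
def form (N : ℕ) : Matrix (Fin N) (Fin N) ℂ :=
  Matrix.of fun i j => if j = i.rev then 1 else 0

/-- The complex special orthogonal group `SO(N)` of the split form: matrices of determinant one
preserving the form. -/
def SO (N : ℕ) : Subgroup (Matrix.SpecialLinearGroup (Fin N) ℂ) where
  carrier := {g | (g : Matrix (Fin N) (Fin N) ℂ).transpose * form N * g = form N}
  one_mem' := by simp
  mul_mem' := by
    intro a b ha hb
    simp only [Set.mem_ofPred_eq] at ha hb ⊢
    rw [Matrix.SpecialLinearGroup.coe_mul, Matrix.transpose_mul]
    calc _ = (b : Matrix (Fin N) (Fin N) ℂ).transpose *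
          ((a : Matrix (Fin N) (Fin N) ℂ).transpose * form N * a) * b := by
            simp only [Matrix.mul_assoc]
      _ = form N := by rw [ha, hb]
  inv_mem' := by
    intro a ha
    simp only [Set.mem_ofPred_eq] at ha ⊢
    have h : (a : Matrix (Fin N) (Fin N) ℂ) * (a⁻¹ : Matrix.SpecialLinearGroup (Fin N) ℂ) = 1 := by
      rw [← Matrix.SpecialLinearGroup.coe_mul, mul_inv_cancel, Matrix.SpecialLinearGroup.coe_one]
    have h' := congrArg Matrix.transpose h
    rw [Matrix.transpose_mul, Matrix.transpose_one] at h'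
    conv_lhs => rw [← ha]
    calc _ = (((a⁻¹ : Matrix.SpecialLinearGroup (Fin N) ℂ) :
            Matrix (Fin N) (Fin N) ℂ).transpose * (a : Matrix (Fin N) (Fin N) ℂ).transpose) *
          form N * ((a : Matrix (Fin N) (Fin N) ℂ) *
            (a⁻¹ : Matrix.SpecialLinearGroup (Fin N) ℂ)) := by
            simp only [Matrix.mul_assoc]
      _ = form N := by rw [h, h', Matrix.one_mul, Matrix.mul_one]

/-- The underlying matrix of an element of `SO(N)`. -/
def toMatrix {N : ℕ} (g : SO N) : Matrix (Fin N) (Fin N) ℂ :=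
  (g : Matrix.SpecialLinearGroup (Fin N) ℂ)

/-- An element of `SO(N)` as a point of the affine space `End(ℂ^N)`. -/
def toPoint {N : ℕ} (g : SO N) : Fin N × Fin N → ℂ := fun p => toMatrix g p.1 p.2

/-- The ideal of all polynomials in the matrix entries that vanish on `SO(N)`. -/
noncomputable def idealSO (N : ℕ) : Ideal (MvPolynomial (Fin N × Fin N) ℂ) :=
  MvPolynomial.vanishingIdeal ℂ (Set.range (toPoint (N := N)))

/-- The coordinate ring `ℂ[SO(N)]`. -/
abbrev CoordRing (N : ℕ) : Type := MvPolynomial (Fin N × Fin N) ℂ ⧸ idealSO N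

/-- Evaluation of a regular function on `SO(N)` at a point. -/
noncomputable def evalAt {N : ℕ} (g : SO N) : CoordRing N →ₐ[ℂ] ℂ :=
  Ideal.Quotient.liftₐ (idealSO N) (MvPolynomial.aeval (toPoint g))
    (fun _ hf => hf (toPoint g) ⟨g, rfl⟩)

/-- The ideal of all regular functions on `SO(N)` that vanish on `S`. -/
noncomputable def vanishingIdeal {N : ℕ} (S : Set (SO N)) : Ideal (CoordRing N) :=
  ⨅ g ∈ S, RingHom.ker (evalAt g)

/-- The common zeros in `SO(N)` of a set of regular functions. -/
def zeroLocus {N : ℕ} (F : Set (CoordRing N)) : Set (SO N) :=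
  {g | ∀ f ∈ F, evalAt g f = 0}

/-- The matrix `A` of coordinate functions on `SO(N)`. -/
noncomputable def coordMatrix (N : ℕ) : Matrix (Fin N) (Fin N) (CoordRing N) :=
  (Matrix.mvPolynomialX (Fin N) (Fin N) ℂ).map (Ideal.Quotient.mk (idealSO N))

/-- The sequence `μ₁, …, μ₁, …, μ_ℓ, …, μ_ℓ` where `μ_i` is repeated `n_i` times. -/
def leftEntries {ℓ : ℕ} (n : Fin ℓ → ℕ) (μ : Fin ℓ → ℂˣ) : List ℂˣ :=
  (List.ofFn fun i => List.replicate (n i) (μ i)).flatten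

/-- The diagonal
`μ₁, …, μ₁, …, μ_ℓ, …, μ_ℓ, -1, 1, …, 1, -1, μ_ℓ⁻¹, …, μ_ℓ⁻¹, …, μ₁⁻¹, …, μ₁⁻¹`
with `P` ones in the middle. -/
def diagEntries {ℓ : ℕ} (n : Fin ℓ → ℕ) (μ : Fin ℓ → ℂˣ) (P : ℕ) : List ℂˣ :=
  leftEntries n μ ++ [-1] ++ List.replicate P 1 ++ [-1] ++
    ((leftEntries n μ).map (·⁻¹)).reverse

theorem length_diagEntries {ℓ : ℕ} (n : Fin ℓ → ℕ) (μ : Fin ℓ → ℂˣ) (P : ℕ) :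
    (diagEntries n μ P).length = 2 * ∑ i, n i + 2 + P := by
  simp [diagEntries, leftEntries, List.map_ofFn, List.sum_ofFn, Function.comp_def]
  ring

theorem reverse_diagEntries {ℓ : ℕ} (n : Fin ℓ → ℕ) (μ : Fin ℓ → ℂˣ) (P : ℕ) :
    (diagEntries n μ P).reverse = (diagEntries n μ P).map (·⁻¹) := by
  simp [diagEntries, List.map_reverse]

theorem prod_diagEntries {ℓ : ℕ} (n : Fin ℓ → ℕ) (μ : Fin ℓ → ℂˣ) (P : ℕ) :
    (diagEntries n μ P).prod = 1 := by
  have h : ((leftEntries n μ).map (·⁻¹)).prod = (leftEntries n μ).prod⁻¹ := by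
    rw [List.prod_inv]
  simp [diagEntries, List.prod_reverse, h]

/-- The `k`-th diagonal entry. -/
def diagEntry {ℓ : ℕ} (n : Fin ℓ → ℕ) (μ : Fin ℓ → ℂˣ) (P : ℕ) {N : ℕ}
    (hN : N = 2 * ∑ i, n i + 2 + P) (k : Fin N) : ℂˣ :=
  (diagEntries n μ P).get (k.cast (hN.trans (length_diagEntries n μ P).symm))

theorem diagEntry_rev {ℓ : ℕ} (n : Fin ℓ → ℕ) (μ : Fin ℓ → ℂˣ) (P : ℕ) {N : ℕ}
    (hN : N = 2 * ∑ i, n i + 2 + P) (k : Fin N) :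
    diagEntry n μ P hN k.rev = (diagEntry n μ P hN k)⁻¹ := by
  have hl := hN.trans (length_diagEntries n μ P).symm
  have hk : (k : ℕ) < (diagEntries n μ P).length := hl ▸ k.2
  have h1 : (diagEntries n μ P).reverse[(k : ℕ)]'(by simpa using hk) =
      ((diagEntries n μ P).map (·⁻¹))[(k : ℕ)]'(by simpa using hk) := by
    simp only [reverse_diagEntries]
  rw [List.getElem_reverse, List.getElem_map] at h1
  simp only [diagEntry, List.get_eq_getElem, Fin.val_cast, Fin.val_rev]
  rw [← h1]
  congr 1
  omega

theorem prod_diagEntry {ℓ : ℕ} (n : Fin ℓ → ℕ) (μ : Fin ℓ → ℂˣ) (P : ℕ) {N : ℕ}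
    (hN : N = 2 * ∑ i, n i + 2 + P) : ∏ k, diagEntry n μ P hN k = 1 := by
  obtain rfl : N = (diagEntries n μ P).length := hN.trans (length_diagEntries n μ P).symm
  rw [← prod_diagEntries n μ P]
  simp [diagEntry, ← List.prod_ofFn]

/-- The diagonal matrix `o`. -/
noncomputable def diagMatrix {ℓ : ℕ} (n : Fin ℓ → ℕ) (μ : Fin ℓ → ℂˣ) (P : ℕ) {N : ℕ}
    (hN : N = 2 * ∑ i, n i + 2 + P) : Matrix (Fin N) (Fin N) ℂ :=
  Matrix.diagonal fun k => (diagEntry n μ P hN k : ℂ)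

theorem det_diagMatrix {ℓ : ℕ} (n : Fin ℓ → ℕ) (μ : Fin ℓ → ℂˣ) (P : ℕ) {N : ℕ}
    (hN : N = 2 * ∑ i, n i + 2 + P) : (diagMatrix n μ P hN).det = 1 := by
  rw [diagMatrix, Matrix.det_diagonal, ← Units.coe_prod, prod_diagEntry, Units.val_one]

theorem diagMatrix_form {ℓ : ℕ} (n : Fin ℓ → ℕ) (μ : Fin ℓ → ℂˣ) (P : ℕ) {N : ℕ}
    (hN : N = 2 * ∑ i, n i + 2 + P) :
    (diagMatrix n μ P hN).transpose * form N * diagMatrix n μ P hN = form N := by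
  ext i j
  rw [diagMatrix, Matrix.diagonal_transpose, Matrix.mul_diagonal, Matrix.diagonal_mul]
  by_cases h : j = i.rev
  · subst h
    simp [form, diagEntry_rev]
  · simp [form, h]

/-- The diagonal matrix `o` as an element of `SO(N)`. -/
noncomputable def basePoint {ℓ : ℕ} (n : Fin ℓ → ℕ) (μ : Fin ℓ → ℂˣ) (P : ℕ) {N : ℕ}
    (hN : N = 2 * ∑ i, n i + 2 + P) : SO N :=
  ⟨⟨diagMatrix n μ P hN, det_diagMatrix n μ P hN⟩, diagMatrix_form n μ P hN⟩

/-- The conjugacy class `O` of `o` in the group `SO(N)`. -/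
def borderlineClass {ℓ : ℕ} (n : Fin ℓ → ℕ) (μ : Fin ℓ → ℂˣ) (P : ℕ) {N : ℕ}
    (hN : N = 2 * ∑ i, n i + 2 + P) : Set (SO N) :=
  {x | IsConj (basePoint n μ P hN) x}

/-- The polynomial
`(X - μ₁) ⋯ (X - μ_ℓ) (X + 1) (X - 1) (X - μ_ℓ⁻¹) ⋯ (X - μ₁⁻¹)`. -/
noncomputable def minPoly {ℓ : ℕ} (μ : Fin ℓ → ℂˣ) : Polynomial ℂ :=
  (∏ i, (Polynomial.X - Polynomial.C (μ i : ℂ))) * (Polynomial.X + 1) * (Polynomial.X - 1) *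
    ∏ i, (Polynomial.X - Polynomial.C ((μ i : ℂ)⁻¹))

/-- The number `∑ i, n_i (μ_i ^ k + μ_i ^ (-k)) + 2 (-1) ^ k + P`. -/
noncomputable def traceValue {ℓ : ℕ} (n : Fin ℓ → ℕ) (μ : Fin ℓ → ℂˣ) (P : ℕ) (k : ℕ) : ℂ :=
  ∑ i, (n i : ℂ) * ((μ i : ℂ) ^ k + ((μ i : ℂ)⁻¹) ^ k) + 2 * (-1) ^ k + (P : ℂ)

/-- The functions on `SO(N)` given by the entries of the minimal polynomial evaluated at the
coordinate matrix `A`. -/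
def minPolyRelations {ℓ : ℕ} (μ : Fin ℓ → ℂˣ) (N : ℕ) : Set (CoordRing N) :=
  {f | ∃ i j, f = (Polynomial.aeval (coordMatrix N) (minPoly μ)) i j}

/-- The functions `Tr(A ^ k) - traceValue k` on `SO(N)`, for `k = 1, …, N`. -/
def traceRelations {ℓ : ℕ} (n : Fin ℓ → ℕ) (μ : Fin ℓ → ℂˣ) (P N : ℕ) : Set (CoordRing N) :=
  {f | ∃ k, 1 ≤ k ∧ k ≤ N ∧
    f = (coordMatrix N ^ k).trace - algebraMap ℂ (CoordRing N) (traceValue n μ P k)}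

end BorderlineSO

/-!
The ideal `J` generated by the relations is shown to contain every function vanishing on the
conjugacy class `O` by a rigidity argument that uses no dimension theory.

**Reduction to nilpotent thickenings.** By Krull's intersection theorem at all maximal ideals
(`mem_of_forall_mem_sup_pow`) and the Nullstellensatz (`eq_ker_evalAt_of_isMaximal`), a function `f`
lies in `J` as soon as it vanishes in `Λ = ℂ[SO(N)] / (J + M ^ k)` for every `k` and the maximal
ideal `M` of every zero `g` of `J` (`mem_of_vanishes`). Over `Λ` the coordinate matrix `A` is
orthogonal, reduces to `g` modulo a nilpotent ideal and satisfies `p(A) = 0`, where `p = minPoly μ`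
is separable.

**Rigidity.** The matrix `A` is then conjugate to the constant matrix `g` over `Λ`
(`exists_orthogonal_intertwiner`). The noncommutative difference quotient `h₀` of `p` at `(A, g)`
satisfies `A h₀ - h₀ g = p(A) - p(g) = 0` and reduces to `p'(g)`, which is invertible; so some `h`
reducing to `1` satisfies `A h = h g`. Its polar part `H = h (h* h) ^ (-1/2)`, where `*` is the
adjoint `adj` with respect to the form, is orthogonal, still intertwines, and still reduces to `1`.

**Passage to complex points.** As `H + 1` is invertible, `H` is a Cayley transform. Cayley
transforms are parametrized by a principal open subset of an affine space, and `f` vanishes at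
`C g C⁻¹` for every complex Cayley transform `C`; hence the corresponding element of a localized
polynomial ring is zero, and so is `f(A) = f(H g H⁻¹)` (`conjValue_cayley`).

**The set of zeros.** A zero `g` of the relations is diagonalizable because `p` is squarefree, and by
Newton's identities the first `N` power traces determine its eigenvalues with multiplicity. So
`g` and the base point are conjugate by an invertible matrix, whose polar part conjugates them in
`O(N)`.
The determinant is corrected by exchanging the two positions of the eigenvalue `-1`, which are
exchanged by the form (`isConj_diagonal`).
-/

namespace BorderlineSO

open Matrix Polynomial

/-! ### The adjoint with respect to the split form -/

section Adjoint

variable {N : ℕ} {R S : Type*}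

/-- The adjoint of a matrix with respect to the split form: the reflection of the matrix in its
antidiagonal. It equals `J * Xᵀ * J`, with `J` the Gram matrix. -/
def adj (X : Matrix (Fin N) (Fin N) R) : Matrix (Fin N) (Fin N) R :=
  (X.submatrix Fin.revPerm Fin.revPerm)ᵀ

theorem adj_apply (X : Matrix (Fin N) (Fin N) R) (i j : Fin N) : adj X i j = X j.rev i.rev := rfl

@[simp] theorem adj_adj (X : Matrix (Fin N) (Fin N) R) : adj (adj X) = X := by
  ext i j; simp [adj_apply]

@[simp] theorem adj_smul {K : Type*} [SMul K R] (c : K) (X : Matrix (Fin N) (Fin N) R) :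
    adj (c • X) = c • adj X := rfl

theorem adj_map (φ : R → S) (X : Matrix (Fin N) (Fin N) R) : adj (X.map φ) = (adj X).map φ := rfl

variable [CommRing R]

@[simp] theorem adj_one : adj (1 : Matrix (Fin N) (Fin N) R) = 1 := by
  simp [adj]

@[simp] theorem adj_add (X Y : Matrix (Fin N) (Fin N) R) : adj (X + Y) = adj X + adj Y := rfl

@[simp] theorem adj_sub (X Y : Matrix (Fin N) (Fin N) R) : adj (X - Y) = adj X - adj Y := rfl

theorem adj_mul (X Y : Matrix (Fin N) (Fin N) R) : adj (X * Y) = adj Y * adj X := by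
  rw [adj, ← submatrix_mul_equiv X Y _ Fin.revPerm, transpose_mul]; rfl

theorem det_adj (X : Matrix (Fin N) (Fin N) R) : (adj X).det = X.det := by
  rw [adj, det_transpose, det_submatrix_equiv_self]

theorem adj_pow (X : Matrix (Fin N) (Fin N) R) (k : ℕ) : adj (X ^ k) = adj X ^ k := by
  induction k with
  | zero => simp
  | succ k ih => rw [pow_succ, adj_mul, ih, pow_succ']

theorem adj_aeval {K : Type*} [CommRing K] [Algebra K R] (X : Matrix (Fin N) (Fin N) R) (r : K[X]) :
    adj (aeval X r) = aeval (adj X) r := by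
  induction r using Polynomial.induction_on' with
  | add p q hp hq => simp [hp, hq]
  | monomial k a =>
    simp [aeval_monomial, Algebra.algebraMap_eq_smul_one, adj_pow]

/-- Preservation of the Gram matrix is the equation `adj X * X = 1`. -/
theorem transpose_mul_form_mul_eq_iff (X : Matrix (Fin N) (Fin N) ℂ) :
    Xᵀ * form N * X = form N ↔ adj X * X = 1 := by
  have h (i j : Fin N) : (Xᵀ * form N * X) i j = (adj X * X) i.rev j := by
    have h' (k : Fin N) : (Xᵀ * form N) i k = X k.rev i := by
      simp only [Matrix.mul_apply, form, of_apply, transpose_apply, mul_ite, mul_one, mul_zero]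
      rw [Finset.sum_eq_single k.rev]
      · simp
      · intro l _ hl
        rw [if_neg]
        rintro rfl
        simp at hl
      · simp
    rw [Matrix.mul_apply, Matrix.mul_apply]
    simp [h', adj_apply]
  have h1 (i j : Fin N) : form N i j = (1 : Matrix (Fin N) (Fin N) ℂ) i.rev j := by
    simp [form, Matrix.one_apply, eq_comm]
  constructor
  · intro hX
    ext i j
    rw [← Fin.rev_rev i, ← h, hX, h1]
  · intro hX
    ext i j
    rw [h, hX, h1]

theorem adj_mul_toMatrix (g : SO N) : adj (toMatrix g) * toMatrix g = 1 :=
  (transpose_mul_form_mul_eq_iff _).1 g.2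

theorem det_toMatrix (g : SO N) : (toMatrix g).det = 1 := g.1.2

/-- The element of `SO(N)` with a given matrix. -/
def SO.mk' (X : Matrix (Fin N) (Fin N) ℂ) (h : adj X * X = 1) (hd : X.det = 1) : SO N :=
  ⟨⟨X, hd⟩, (transpose_mul_form_mul_eq_iff X).2 h⟩

theorem toMatrix_mk' (X : Matrix (Fin N) (Fin N) ℂ) (h : adj X * X = 1) (hd : X.det = 1) :
    toMatrix (SO.mk' X h hd) = X := rfl

theorem toMatrix_mul (g h : SO N) : toMatrix (g * h) = toMatrix g * toMatrix h := rfl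

theorem toMatrix_injective : Function.Injective (toMatrix (N := N)) := fun _ _ h =>
  Subtype.ext (Subtype.ext h)

/-- Two elements of `SO(N)` are conjugate as soon as an element of `SO(N)` intertwines them. -/
theorem isConj_of_mul_eq {x y : SO N} (C : Matrix (Fin N) (Fin N) ℂ) (h : adj C * C = 1)
    (hd : C.det = 1) (hC : C * toMatrix x = toMatrix y * C) : IsConj x y :=
  isConj_iff.2 ⟨SO.mk' C h hd, by
    rw [mul_inv_eq_iff_eq_mul]
    exact toMatrix_injective hC⟩

end Adjoint

/-! ### Square roots and polar decomposition -/

section SquareRoot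

/-- Let `r(q)² q - 1` be nilpotent. Then the approximate inverse square root `r(q)` of `q` can be
corrected, by a nilpotent polynomial in `q`, to an exact one. -/
theorem exists_aeval_sq_mul_eq_one {E : Type*} [Ring E] [Algebra ℂ E] (q : E) (r₀ : ℂ[X])
    (h : IsNilpotent (aeval q r₀ ^ 2 * q - 1)) :
    ∃ r : ℂ[X], aeval q r ^ 2 * q = 1 ∧ IsNilpotent (aeval q r₀ - aeval q r) := by
  let q' : Algebra.adjoin ℂ {q} := ⟨q, Algebra.self_mem_adjoin_singleton ℂ q⟩
  have hcoe (r : ℂ[X]) : ((aeval q' r : Algebra.adjoin ℂ {q}) : E) = aeval q r := by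
    rw [← Subalgebra.coe_val, ← Polynomial.aeval_algHom_apply]; rfl
  let x := aeval q' r₀
  have hn : IsNilpotent (x ^ 2 * q' - 1) := by
    obtain ⟨k, hk⟩ := h
    refine ⟨k, Subtype.ext ?_⟩
    push_cast
    rw [hcoe]
    exact hk
  have hu : IsUnit (x ^ 2 * q') := by
    simpa only [sub_add_cancel] using hn.isUnit_add_one
  let F : (Algebra.adjoin ℂ {q})[X] := X ^ 2 * C q' - 1
  have hF : IsNilpotent (aeval x F) := by
    simpa only [F, map_sub, map_mul, map_pow, aeval_X, aeval_C, map_one,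
      Algebra.algebraMap_self_apply] using hn
  have h2 : IsUnit (2 : Algebra.adjoin ℂ {q}) := by
    have := (isUnit_iff_ne_zero.2 (two_ne_zero (α := ℂ))).map
      (algebraMap ℂ (Algebra.adjoin ℂ {q}))
    rwa [map_ofNat] at this
  have hF' : IsUnit (aeval x (derivative F)) := by
    have : aeval x (derivative F) = 2 * (x * q') := by
      simp [F, derivative_pow]
      ring
    rw [this]
    refine h2.mul (isUnit_of_mul_isUnit_right (x := x) ?_)
    convert hu using 1
    ring
  obtain ⟨s, ⟨hs1, hs2⟩, -⟩ := Polynomial.existsUnique_nilpotent_sub_and_aeval_eq_zero hF hF'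
  obtain ⟨r, hr⟩ : ∃ r : ℂ[X], aeval q r = (s : E) := by
    have : (s : E) ∈ (aeval q : ℂ[X] →ₐ[ℂ] E).range :=
      Algebra.adjoin_singleton_eq_range_aeval ℂ q ▸ s.2
    exact this
  refine ⟨r, ?_, ?_⟩
  · have hs3 : s ^ 2 * q' - 1 = 0 := by
      simpa only [F, map_sub, map_mul, map_pow, aeval_X, aeval_C, map_one,
        Algebra.algebraMap_self_apply] using hs2
    have := congrArg Subtype.val hs3
    rw [hr, ← sub_eq_zero]
    push_cast at this
    exact this
  · obtain ⟨k, hk⟩ := hs1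
    refine ⟨k, ?_⟩
    have := congrArg Subtype.val hk
    push_cast at this
    rw [hcoe] at this
    rw [hr]
    exact this

theorem semiconjBy_aeval {K E : Type*} [CommRing K] [Ring E] [Algebra K E] {h a b : E}
    (hab : SemiconjBy h a b) (p : K[X]) : SemiconjBy h (aeval a p) (aeval b p) := by
  induction p using Polynomial.induction_on' with
  | add p q hp hq => rw [map_add, map_add]; exact hp.add_right hq
  | monomial k c =>
    rw [aeval_monomial, aeval_monomial]
    exact SemiconjBy.mul_right (Algebra.commutes c h).symm (hab.pow_right k)

/-- The polar decomposition: if an intertwiner `h` between orthogonal matrices is invertible, then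
`h * s` is an orthogonal intertwiner, where `s` is an inverse square root of `adj h * h` that is a
polynomial in `adj h * h`. -/
theorem polar_intertwiner {N : ℕ} {R : Type*} [CommRing R] [Algebra ℂ R]
    {A g h : Matrix (Fin N) (Fin N) R} (hA : adj A * A = 1) (hg : adj g * g = 1)
    (hh : A * h = h * g) {r : ℂ[X]} (hr : aeval (adj h * h) r ^ 2 * (adj h * h) = 1) :
    adj (h * aeval (adj h * h) r) * (h * aeval (adj h * h) r) = 1 ∧
      A * (h * aeval (adj h * h) r) = h * aeval (adj h * h) r * g := by
  set q := adj h * h with hq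
  have hA' : A * adj A = 1 := mul_eq_one_comm.1 hA
  have hg' : g * adj g = 1 := mul_eq_one_comm.1 hg
  have hqadj : adj q = q := by rw [hq, adj_mul, adj_adj]
  -- Taking adjoints in `A h = h g` gives `q = g⁻¹ q g`, so `g` commutes with `q` and with `s`.
  have hgq : Commute g q := by
    have h1 : adj h * adj A = adj g * adj h := by rw [← adj_mul, hh, adj_mul]
    have h2 : q = adj g * q * g := by
      calc q = adj h * (adj A * A) * h := by rw [hA, mul_one]
        _ = (adj h * adj A) * (A * h) := by simp only [mul_assoc]
        _ = adj g * q * g := by rw [h1, hh, hq]; simp only [mul_assoc]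
    calc g * q = (g * adj g) * (q * g) := by conv_lhs => rw [h2]
                                             simp only [mul_assoc]
      _ = q * g := by rw [hg', one_mul]
  have hgs : Commute g (aeval q r) := semiconjBy_aeval hgq r
  have hqs : Commute q (aeval q r) := semiconjBy_aeval (Commute.refl q) r
  constructor
  · rw [adj_mul, adj_aeval, hqadj, mul_assoc, ← mul_assoc (adj h), ← hq, hqs.eq, ← mul_assoc,
      ← sq, hr]
  · rw [← mul_assoc, hh, mul_assoc, hgs.eq, mul_assoc]

end SquareRoot

/-! ### Intertwiners from noncommutative difference quotients -/

section Intertwiner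

/-- The noncommutative difference quotient `(p(A) - p(g)) / (A - g)`: it intertwines `A` and `g` up
to `p(A) - p(g)`, and it specializes to `p'(g)` where `A` and `g` agree. -/
theorem exists_intertwiner {K E F : Type*} [CommRing K] [Ring E] [Ring F] [Algebra K E]
    [Algebra K F] (π : E →ₐ[K] F) {A g : E} (hπ : π A = π g) (p : K[X]) :
    ∃ h : E, A * h - h * g = aeval A p - aeval g p ∧ π h = aeval (π g) (derivative p) := by
  induction p using Polynomial.induction_on with
  | C a => exact ⟨0, by simp⟩
  | add p q hp hq =>
    obtain ⟨h₁, h₁1, h₁2⟩ := hp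
    obtain ⟨h₂, h₂1, h₂2⟩ := hq
    refine ⟨h₁ + h₂, ?_, by simp [h₁2, h₂2]⟩
    rw [mul_add, add_mul, add_sub_add_comm, h₁1, h₂1, map_add, map_add, add_sub_add_comm]
  | monomial k a ih =>
    obtain ⟨h, h1, h2⟩ := ih
    have hX : C a * X ^ (k + 1) = X * (C a * X ^ k) := by ring
    rw [hX]
    generalize C a * X ^ k = p at h1 h2
    refine ⟨A * h + aeval g p, ?_, ?_⟩
    · have hc : g * aeval g p = aeval g p * g := by
        have := congrArg (aeval g) (X_mul (p := p))
        simpa only [map_mul, aeval_X] using this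
      rw [map_mul, map_mul, aeval_X, aeval_X, hc]
      have : A * (A * h - h * g) = A * (aeval A p - aeval g p) := by rw [h1]
      rw [mul_sub, mul_sub] at this
      rw [mul_add, add_mul, mul_assoc, add_sub_add_comm, this]
      abel
    · rw [derivative_mul]
      simp only [map_add, map_mul, hπ, h2, derivative_X, one_mul, aeval_X, aeval_algHom_apply]
      rw [add_comm]

end Intertwiner

/-! ### Rigidity over nilpotent thickenings -/

section NilpotentThickening

variable {Λ : Type*} [CommRing Λ] [Algebra ℂ Λ] {π : Λ →ₐ[ℂ] ℂ} {k : ℕ} {N : ℕ}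

/-- With `ker π` nilpotent, `Λ` is local with residue field `ℂ`. -/
theorem isUnit_of_map_ne_zero (hπ : RingHom.ker π ^ k = ⊥) {a : Λ} (ha : π a ≠ 0) : IsUnit a := by
  have hn : IsNilpotent (a - algebraMap ℂ Λ (π a)) := by
    refine ⟨k, ?_⟩
    have : a - algebraMap ℂ Λ (π a) ∈ RingHom.ker π := by simp [RingHom.mem_ker]
    simpa [hπ] using Ideal.pow_mem_pow this k
  have hu : IsUnit (algebraMap ℂ Λ (π a)) := (isUnit_iff_ne_zero.2 ha).map _
  simpa using hn.isUnit_add_left_of_commute hu (Commute.all _ _)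

theorem isUnit_det_of_map (hπ : RingHom.ker π ^ k = ⊥) {X : Matrix (Fin N) (Fin N) Λ}
    (hX : (X.map π).det ≠ 0) : IsUnit X.det := by
  refine isUnit_of_map_ne_zero hπ (π := π) ?_
  rwa [AlgHom.map_det]

theorem isNilpotent_of_map_eq_zero (hπ : RingHom.ker π ^ k = ⊥) {X : Matrix (Fin N) (Fin N) Λ}
    (hX : X.map π = 0) : IsNilpotent X := by
  have hX' (i j : Fin N) : X i j ∈ RingHom.ker π := congrFun (congrFun hX i) j
  have h (m : ℕ) : ∀ i j, (X ^ m) i j ∈ RingHom.ker π ^ m := by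
    induction m with
    | zero => simp
    | succ m ih =>
      intro i j
      rw [pow_succ, pow_succ, Matrix.mul_apply]
      exact Ideal.sum_mem _ fun l _ => Ideal.mul_mem_mul (ih i l) (hX' l j)
  refine ⟨k, ?_⟩
  ext i j
  simpa [hπ] using h k i j

/-- An orthogonal matrix over a nilpotent thickening of `ℂ` that is annihilated by a separable
complex polynomial is conjugate to its reduction, by an orthogonal matrix reducing to `1`. -/
theorem exists_orthogonal_intertwiner (hπ : RingHom.ker π ^ k = ⊥)
    {A : Matrix (Fin N) (Fin N) Λ} (hA : adj A * A = 1) {p : ℂ[X]} (hp : p.Separable)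
    (hpA : aeval A p = 0) :
    ∃ H : Matrix (Fin N) (Fin N) Λ, adj H * H = 1 ∧
      A * H = H * (A.map π).map (algebraMap ℂ Λ) ∧ H.map π = 1 := by
  let ρ : Matrix (Fin N) (Fin N) Λ →ₐ[ℂ] Matrix (Fin N) (Fin N) ℂ := π.mapMatrix
  let ι : Matrix (Fin N) (Fin N) ℂ →ₐ[ℂ] Matrix (Fin N) (Fin N) Λ := (Algebra.ofId ℂ Λ).mapMatrix
  have hρι (X : Matrix (Fin N) (Fin N) ℂ) : ρ (ι X) = X := by
    ext i j
    exact π.commutes (X i j)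
  have hρA : adj (ρ A) * ρ A = 1 := by
    have : ρ (adj A * A) = 1 := by rw [hA, map_one]
    rwa [map_mul] at this
  set g := ι (ρ A) with hg
  have hgadj : adj g * g = 1 := by
    have : ι (adj (ρ A) * ρ A) = 1 := by rw [hρA, map_one]
    rwa [map_mul] at this
  have hpρ : aeval (ρ A) p = 0 := by rw [aeval_algHom_apply, hpA, map_zero]
  have hpg : aeval g p = 0 := by rw [hg, aeval_algHom_apply, hpρ, map_zero]
  obtain ⟨h₀, h1, h2⟩ := exists_intertwiner ρ (A := A) (g := g) (hρι _).symm p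
  rw [hpA, hpg, sub_self, sub_eq_zero] at h1
  obtain ⟨u, v, huv⟩ := hp
  -- `p'(g)` is invertible with inverse `v(g)`, because `u p + v p' = 1`.
  set h := h₀ * aeval g v with hh
  have hAh : A * h = h * g := by
    rw [hh, ← mul_assoc, h1, mul_assoc, mul_assoc,
      (semiconjBy_aeval (Commute.refl g) v).eq]
  have hρh : ρ h = 1 := by
    have := congrArg (aeval (ρ A)) huv
    rw [map_add, map_mul, map_mul, hpρ, mul_zero, zero_add, map_one] at this
    rw [hh, map_mul, h2, ← aeval_algHom_apply, hg, hρι, ← map_mul, mul_comm, map_mul, this]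
  have hρq : ρ (adj h * h) = 1 := by
    rw [map_mul, hρh, mul_one]
    exact (congrArg adj hρh).trans adj_one
  -- `adj h * h` reduces to `1`, so the constant `1` is an approximate inverse square root.
  obtain ⟨r, hr1, hr2⟩ := exists_aeval_sq_mul_eq_one (adj h * h) 1 (by
    rw [map_one, one_pow, one_mul]
    refine isNilpotent_of_map_eq_zero hπ (π := π) ?_
    change ρ _ = 0
    rw [map_sub, hρq, map_one, sub_self])
  obtain ⟨h3, h4⟩ := polar_intertwiner hA hgadj hAh hr1
  refine ⟨_, h3, h4, ?_⟩
  change ρ _ = 1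
  have hs : ρ (aeval (adj h * h) r) = algebraMap ℂ _ (r.eval 1) := by
    rw [← aeval_algHom_apply, hρq, ← map_one (algebraMap ℂ (Matrix (Fin N) (Fin N) ℂ)),
      aeval_algebraMap_apply]
    simp
  -- The exact one reduces to a scalar matrix that differs from `1` by a nilpotent.
  have hn : IsNilpotent (algebraMap ℂ (Matrix (Fin N) (Fin N) ℂ) (1 - r.eval 1)) := by
    have := hr2.map ρ
    rwa [map_sub, hs, map_one, map_one, ← map_one (algebraMap ℂ (Matrix (Fin N) (Fin N) ℂ)),
      ← map_sub] at this
  rw [map_mul, hρh, one_mul, hs]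
  rcases isEmpty_or_nonempty (Fin N) with hN | hN
  · exact Subsingleton.elim _ _
  · rw [IsNilpotent.map_iff (FaithfulSMul.algebraMap_injective ℂ _)] at hn
    rw [← sub_eq_zero.1 hn.eq_zero, map_one]

end NilpotentThickening

/-! ### The Cayley transform -/

section Cayley

variable {N : ℕ} {R S : Type*} [CommRing R] [CommRing S]

/-- The skew-adjoint part (up to a factor 2) of a matrix. -/
def skew (Z : Matrix (Fin N) (Fin N) R) : Matrix (Fin N) (Fin N) R := Z - adj Z

/-- The Cayley transform `(1 + Y) (1 - Y)⁻¹` of the skew-adjoint matrix `Y = Z - adj Z`, where `d`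
stands for the inverse of the determinant of `1 - Y`. -/
def cayley (Z : Matrix (Fin N) (Fin N) R) (d : R) : Matrix (Fin N) (Fin N) R :=
  d • ((1 + skew Z) * (1 - skew Z).adjugate)

theorem adj_skew (Z : Matrix (Fin N) (Fin N) R) : adj (skew Z) = -skew Z := by
  simp [skew]

theorem skew_map (φ : R →+* S) (Z : Matrix (Fin N) (Fin N) R) :
    skew (Z.map φ) = (skew Z).map φ := by
  ext i j; simp [skew, adj_apply]

theorem cayley_map (φ : R →+* S) (Z : Matrix (Fin N) (Fin N) R) (d : R) :
    cayley (Z.map φ) (φ d) = (cayley Z d).map φ := by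
  have h : (cayley Z d).map φ = φ.mapMatrix (d • ((1 + skew Z) * (1 - skew Z).adjugate)) := rfl
  have h' (X : Matrix (Fin N) (Fin N) R) : φ.mapMatrix (d • X) = φ d • φ.mapMatrix X := by
    ext i j; simp
  rw [h, h', map_mul, RingHom.map_adjugate, map_add, map_sub, map_one, cayley, skew_map]
  rfl

theorem cayley_mul {Z : Matrix (Fin N) (Fin N) R} {d : R} (hd : d * (1 - skew Z).det = 1) :
    cayley Z d * (1 - skew Z) = 1 + skew Z := by
  rw [cayley, smul_mul_assoc, mul_assoc, adjugate_mul, mul_smul_comm, smul_smul, hd, one_smul,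
    mul_one]

theorem det_one_add_skew (Z : Matrix (Fin N) (Fin N) R) :
    (1 + skew Z).det = (1 - skew Z).det := by
  rw [← det_adj]; simp [adj_skew, sub_eq_add_neg]

theorem det_cayley {Z : Matrix (Fin N) (Fin N) R} {d : R} (hd : d * (1 - skew Z).det = 1) :
    (cayley Z d).det = 1 := by
  have h := congrArg det (cayley_mul hd)
  rw [det_mul, det_one_add_skew] at h
  calc (cayley Z d).det = d * ((cayley Z d).det * (1 - skew Z).det) := by
        linear_combination -(cayley Z d).det * hd
    _ = 1 := by rw [h, hd]

theorem adj_cayley_mul {Z : Matrix (Fin N) (Fin N) R} {d : R} (hd : d * (1 - skew Z).det = 1) :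
    adj (cayley Z d) * cayley Z d = 1 := by
  have h1 := cayley_mul hd
  have h2 : (1 + skew Z) * adj (cayley Z d) = 1 - skew Z := by
    have := congrArg adj h1
    rw [adj_mul] at this
    simpa only [adj_sub, adj_add, adj_one, adj_skew, sub_neg_eq_add, ← sub_eq_add_neg] using this
  have hu : IsUnit (1 - skew Z) := by
    rw [isUnit_iff_isUnit_det]
    exact IsUnit.of_mul_eq_one_right _ hd
  have hu' : IsUnit (1 + skew Z) := by
    rw [isUnit_iff_isUnit_det, det_one_add_skew, ← isUnit_iff_isUnit_det]
    exact hu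
  apply hu.mul_right_cancel
  apply hu'.mul_left_cancel
  rw [mul_assoc, h1, ← mul_assoc, h2]
  noncomm_ring

/-- An orthogonal matrix `H` with `H + 1` invertible is a Cayley transform. -/
theorem exists_eq_cayley [Algebra ℂ R] {H : Matrix (Fin N) (Fin N) R} (hH : adj H * H = 1)
    (hu : IsUnit (H + 1).det) :
    ∃ (Z : Matrix (Fin N) (Fin N) R) (d : R), d * (1 - skew Z).det = 1 ∧ H = cayley Z d := by
  obtain ⟨B, hB1, hB2⟩ : ∃ B, (H + 1) * B = 1 ∧ B * (H + 1) = 1 :=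
    ⟨(H + 1)⁻¹, mul_nonsing_inv _ hu, nonsing_inv_mul _ hu⟩
  -- The inverse Cayley transform of `H`.
  set Y := (H - 1) * B with hY
  have hHB : Commute H B := by
    have : Commute (H + 1) B := hB1.trans hB2.symm
    simpa using this.sub_left (Commute.one_left B)
  have hY' : Y = B * (H - 1) := ((hHB.sub_left (Commute.one_left B)).eq)
  have hY2 : Y * (H + 1) = H - 1 := by rw [hY, mul_assoc, hB2, mul_one]
  have hadj : adj Y = -Y := by
    have h := congrArg adj hY2
    rw [adj_mul, adj_add, adj_sub, adj_one] at h
    have h' : H * ((adj H + 1) * adj Y) = H * (adj H - 1) := by rw [h]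
    rw [← mul_assoc, mul_add, mul_sub, mul_one, mul_eq_one_comm.1 hH] at h'
    calc adj Y = B * ((H + 1) * adj Y) := by rw [← mul_assoc, hB2, one_mul]
      _ = -Y := by rw [add_comm H, h', hY']; noncomm_ring
  have hskew : skew ((1 / 2 : ℂ) • Y) = Y := by
    rw [skew, adj_smul, hadj, smul_neg, sub_neg_eq_add, ← add_smul]
    norm_num
  have h1 : 1 - Y = (2 : ℂ) • B := by
    calc 1 - Y = (H + 1) * B - (H - 1) * B := by rw [hB1]
      _ = (2 : ℂ) • B := by rw [two_smul]; noncomm_ring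
  have h2 : H * (1 - Y) = 1 + Y := by
    rw [mul_sub, mul_one]
    have : Y * H + Y = H - 1 := by rw [← hY2]; noncomm_ring
    have hc : H * Y = Y * H := by
      rw [hY, ← mul_assoc, mul_assoc _ B H, ← hHB.eq]
      noncomm_ring
    rw [hc, eq_sub_of_add_eq this]
    abel
  have hu2 : IsUnit (1 - Y) := by
    refine ⟨⟨1 - Y, (1 / 2 : ℂ) • (H + 1), ?_, ?_⟩, rfl⟩ <;> rw [h1]
    · rw [smul_mul_smul_comm, hB2]; norm_num
    · rw [smul_mul_smul_comm, hB1]; norm_num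
  obtain ⟨d, hd⟩ := ((isUnit_iff_isUnit_det _).1 hu2).exists_left_inv
  refine ⟨(1 / 2 : ℂ) • Y, d, by rwa [hskew], ?_⟩
  apply hu2.mul_right_cancel
  have := cayley_mul (Z := (1 / 2 : ℂ) • Y) (d := d) (by rwa [hskew])
  rw [hskew] at this
  rw [h2, this]

end Cayley

/-! ### Functions on `SO(N)` and on its conjugacy classes -/

/-- An element of a principal localization of a polynomial ring over an infinite field vanishes if
it vanishes at all rational points. -/
theorem eq_zero_of_forall_algHom {σ K T : Type*} [Field K] [Infinite K] [CommRing T]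
    [Algebra (MvPolynomial σ K) T] [Algebra K T] [IsScalarTower K (MvPolynomial σ K) T]
    (D : MvPolynomial σ K) [IsLocalization.Away D T] (x : T) (hx : ∀ ψ : T →ₐ[K] K, ψ x = 0) :
    x = 0 := by
  obtain ⟨s, ⟨_, k, rfl⟩, hs⟩ := IsLocalization.exists_mk'_eq (Submonoid.powers D) x
  have hxs : x * algebraMap _ T (D ^ k) = algebraMap _ T s := by
    rw [← hs]; exact IsLocalization.mk'_spec _ _ _
  -- The numerator `s` vanishes wherever `D` does not, so `s * D` vanishes at every point.
  have hsD : s * D = 0 := by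
    apply MvPolynomial.funext
    intro z
    rw [map_mul, map_zero]
    by_cases hz : MvPolynomial.eval z D = 0
    · rw [hz, mul_zero]
    · let ψ : T →ₐ[K] K := IsLocalization.liftAlgHom (M := Submonoid.powers D)
        (f := MvPolynomial.aeval z) (by
          rintro ⟨_, m, rfl⟩
          rw [map_pow]
          exact (isUnit_iff_ne_zero.2 (by rwa [MvPolynomial.aeval_eq_eval])).pow m)
      have h := congrArg ψ hxs
      rw [map_mul, hx, zero_mul] at h
      have h' : ψ (algebraMap _ T s) = MvPolynomial.eval z s := by
        rw [← MvPolynomial.aeval_eq_eval]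
        exact IsLocalization.lift_eq _ _
      rw [← h', ← h, zero_mul]
  have hu : IsUnit (algebraMap _ T D) := IsLocalization.Away.algebraMap_isUnit D
  have hs0 : algebraMap _ T s = 0 := by
    have := congrArg (algebraMap _ T) hsD
    rw [map_mul, map_zero] at this
    exact hu.mul_left_eq_zero.1 this
  rw [hs0, map_pow] at hxs
  exact (hu.pow k).mul_left_eq_zero.1 hxs

section CoordinateRing

variable {N : ℕ}

theorem evalAt_mk (g : SO N) (F : MvPolynomial (Fin N × Fin N) ℂ) :
    evalAt g (Ideal.Quotient.mk (idealSO N) F) = MvPolynomial.aeval (toPoint g) F := rfl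

theorem coordMatrix_map_evalAt (g : SO N) : (coordMatrix N).map (evalAt g) = toMatrix g := by
  ext i j
  simp [coordMatrix, evalAt_mk, Matrix.mvPolynomialX, toPoint]

/-- Regular functions are determined by their values, because `idealSO` is a vanishing ideal. -/
theorem eq_of_evalAt {x y : CoordRing N} (h : ∀ g, evalAt g x = evalAt g y) : x = y := by
  obtain ⟨x, rfl⟩ := Ideal.Quotient.mk_surjective x
  obtain ⟨y, rfl⟩ := Ideal.Quotient.mk_surjective y
  rw [Ideal.Quotient.eq, idealSO, MvPolynomial.mem_vanishingIdeal_iff]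
  rintro _ ⟨g, rfl⟩
  have := h g
  rw [evalAt_mk, evalAt_mk] at this
  rw [map_sub, this, sub_self]

theorem matrix_eq_of_evalAt {X Y : Matrix (Fin N) (Fin N) (CoordRing N)}
    (h : ∀ g, X.map (evalAt g) = Y.map (evalAt g)) : X = Y := by
  ext i j
  exact eq_of_evalAt fun g => congrFun (congrFun (h g) i) j

theorem adj_coordMatrix_mul : adj (coordMatrix N) * coordMatrix N = 1 := by
  apply matrix_eq_of_evalAt
  intro g
  have h : (adj (coordMatrix N) * coordMatrix N).map (evalAt g) =
      (evalAt g).mapMatrix (adj (coordMatrix N) * coordMatrix N) := rfl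
  have h1 : (1 : Matrix (Fin N) (Fin N) (CoordRing N)).map (evalAt g) =
      (evalAt g).mapMatrix 1 := rfl
  rw [h, map_mul, h1, map_one, AlgHom.mapMatrix_apply, AlgHom.mapMatrix_apply, ← adj_map,
    coordMatrix_map_evalAt, adj_mul_toMatrix]

theorem algHom_apply_mk {Λ : Type*} [CommRing Λ] [Algebra ℂ Λ] (φ : CoordRing N →ₐ[ℂ] Λ)
    (F : MvPolynomial (Fin N × Fin N) ℂ) :
    φ (Ideal.Quotient.mk (idealSO N) F) =
      MvPolynomial.aeval (fun p => ((coordMatrix N).map φ) p.1 p.2) F := by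
  have : φ.comp (Ideal.Quotient.mkₐ ℂ (idealSO N)) =
      MvPolynomial.aeval (fun p => ((coordMatrix N).map φ) p.1 p.2) := by
    ext p
    simp [coordMatrix, Matrix.mvPolynomialX]
  exact DFunLike.congr_fun this F

/-- The complex points of the coordinate ring are the elements of `SO(N)`. -/
theorem algHom_eq_evalAt (χ : CoordRing N →ₐ[ℂ] ℂ) : ∃ g, χ = evalAt g := by
  set X := (coordMatrix N).map χ with hX
  have h1 : adj X * X = 1 := by
    have := congrArg χ.mapMatrix (adj_coordMatrix_mul (N := N))
    rwa [map_mul, map_one] at this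
  have hdet : (coordMatrix N).det = 1 := by
    apply eq_of_evalAt
    intro g
    rw [AlgHom.map_det, map_one, AlgHom.mapMatrix_apply, coordMatrix_map_evalAt, det_toMatrix]
  have h2 : X.det = 1 := by
    rw [hX, ← AlgHom.mapMatrix_apply, ← AlgHom.map_det, hdet, map_one]
  refine ⟨SO.mk' X h1 h2, ?_⟩
  ext f
  obtain ⟨F, rfl⟩ := Ideal.Quotient.mk_surjective f
  rw [algHom_apply_mk, algHom_apply_mk, coordMatrix_map_evalAt, toMatrix_mk']

/-- The weak Nullstellensatz for `ℂ[SO(N)]`. -/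
theorem eq_ker_evalAt_of_isMaximal (M : Ideal (CoordRing N)) [M.IsMaximal] :
    ∃ g, M = RingHom.ker (evalAt g) := by
  let _ : Field (CoordRing N ⧸ M) := Ideal.Quotient.field M
  have hb : Function.Bijective (algebraMap ℂ (CoordRing N ⧸ M)) := by
    have : Algebra.FiniteType ℂ (CoordRing N ⧸ M) := inferInstance
    have : Module.Finite ℂ (CoordRing N ⧸ M) := finite_of_finite_type_of_isJacobsonRing _ _
    exact IsAlgClosed.algebraMap_bijective_of_isIntegral
  let e := AlgEquiv.ofBijective (Algebra.ofId ℂ (CoordRing N ⧸ M)) hb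
  obtain ⟨g, hg⟩ := algHom_eq_evalAt (e.symm.toAlgHom.comp (Ideal.Quotient.mkₐ ℂ M))
  refine ⟨g, ?_⟩
  rw [← hg]
  ext x
  simp [RingHom.mem_ker, Ideal.Quotient.eq_zero_iff_mem]

theorem mem_vanishingIdeal_iff {S : Set (SO N)} {f : CoordRing N} :
    f ∈ vanishingIdeal S ↔ ∀ g ∈ S, evalAt g f = 0 := by
  simp [vanishingIdeal, RingHom.mem_ker]

/-- The value of a polynomial function at the matrix `C * g * adj C`. -/
noncomputable def conjValue {U : Type*} [CommRing U] [Algebra ℂ U] (g : Matrix (Fin N) (Fin N) ℂ)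
    (F : MvPolynomial (Fin N × Fin N) ℂ) (C : Matrix (Fin N) (Fin N) U) : U :=
  MvPolynomial.aeval (fun p : Fin N × Fin N => (C * g.map (algebraMap ℂ U) * adj C) p.1 p.2) F

theorem map_conjValue {U V : Type*} [CommRing U] [Algebra ℂ U] [CommRing V] [Algebra ℂ V]
    (ψ : U →ₐ[ℂ] V) (g : Matrix (Fin N) (Fin N) ℂ) (F : MvPolynomial (Fin N × Fin N) ℂ)
    (C : Matrix (Fin N) (Fin N) U) : ψ (conjValue g F C) = conjValue g F (C.map ψ) := by
  have h : (C * g.map (algebraMap ℂ U) * adj C).map ψ =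
      C.map ψ * g.map (algebraMap ℂ V) * adj (C.map ψ) := by
    have h1 : (C * g.map (algebraMap ℂ U) * adj C).map ψ =
      ψ.mapMatrix (C * g.map (algebraMap ℂ U) * adj C) := rfl
    have h2 : ψ.mapMatrix (g.map (algebraMap ℂ U)) = g.map (algebraMap ℂ V) := by
      ext i j
      exact ψ.commutes _
    rw [h1, map_mul, map_mul, h2]
    rfl
  rw [conjValue, conjValue, ← h, ← AlgHom.comp_apply, MvPolynomial.comp_aeval]
  rfl

/-- The denominator condition of the Cayley transform is preserved by algebra maps. -/
theorem cayley_den_map {U V : Type*} [CommRing U] [CommRing V] (ψ : U →+* V)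
    {Z : Matrix (Fin N) (Fin N) U} {d : U} (hd : d * (1 - skew Z).det = 1) :
    ψ d * (1 - skew (Z.map ψ)).det = 1 := by
  have h := congrArg ψ hd
  rwa [map_mul, map_one, RingHom.map_det, map_sub, map_one, RingHom.mapMatrix_apply,
    ← skew_map] at h

theorem conjValue_cayley_complex {g : SO N} {F : MvPolynomial (Fin N × Fin N) ℂ}
    (hF : ∀ x, IsConj g x → evalAt x (Ideal.Quotient.mk (idealSO N) F) = 0)
    {Z : Matrix (Fin N) (Fin N) ℂ} {d : ℂ} (hd : d * (1 - skew Z).det = 1) :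
    conjValue (toMatrix g) F (cayley Z d) = 0 := by
  have hCadj : adj (cayley Z d) * cayley Z d = 1 := adj_cayley_mul hd
  let y : SO N := SO.mk' (cayley Z d) hCadj (det_cayley hd)
  have hy : toMatrix (y * g * y⁻¹) = cayley Z d * toMatrix g * adj (cayley Z d) := by
    have h3 : toMatrix (y * g * y⁻¹) * cayley Z d = cayley Z d * toMatrix g := by
      change toMatrix (y * g * y⁻¹ * y) = toMatrix (y * g)
      rw [inv_mul_cancel_right]
    rw [← h3, Matrix.mul_assoc, mul_eq_one_comm.1 hCadj, Matrix.mul_one]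
  have h4 := hF (y * g * y⁻¹) (isConj_iff.2 ⟨y, rfl⟩)
  rw [algHom_apply_mk, coordMatrix_map_evalAt, hy] at h4
  exact h4

/-- A polynomial vanishing on the conjugacy class of `g` vanishes at every matrix `H g H⁻¹` with `H`
a Cayley transform over a `ℂ`-algebra: the Cayley transforms are parametrized by a principal open
subset of an affine space, and the function vanishes at the complex points of that subset. -/
theorem conjValue_cayley {g : SO N} {F : MvPolynomial (Fin N × Fin N) ℂ}
    (hF : ∀ x, IsConj g x → evalAt x (Ideal.Quotient.mk (idealSO N) F) = 0)
    {Λ : Type*} [CommRing Λ] [Algebra ℂ Λ] {Z : Matrix (Fin N) (Fin N) Λ} {d : Λ}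
    (hd : d * (1 - skew Z).det = 1) : conjValue (toMatrix g) F (cayley Z d) = 0 := by
  -- `T` is the coordinate ring of the open set on which the generic Cayley transform is defined.
  let D : MvPolynomial (Fin N × Fin N) ℂ := (1 - skew (Matrix.mvPolynomialX (Fin N) (Fin N) ℂ)).det
  let T := Localization.Away D
  let ZT : Matrix (Fin N) (Fin N) T :=
    (Matrix.mvPolynomialX (Fin N) (Fin N) ℂ).map (algebraMap _ T)
  let dT : T := IsLocalization.Away.invSelf D
  have hdT : dT * (1 - skew ZT).det = 1 := by
    have h1 : (1 - skew ZT).det = algebraMap _ T D := by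
      rw [RingHom.map_det, map_sub, map_one, skew_map]; rfl
    rw [h1, mul_comm]
    exact IsLocalization.Away.mul_invSelf D
  have hx : conjValue (toMatrix g) F (cayley ZT dT) = 0 := by
    refine eq_zero_of_forall_algHom D _ fun ψ => ?_
    rw [map_conjValue]
    refine (congrArg _ (cayley_map (ψ : T →+* ℂ) ZT dT).symm).trans ?_
    exact conjValue_cayley_complex hF (cayley_den_map (ψ : T →+* ℂ) hdT)
  -- The given pair `(Z, d)` over `Λ` is a specialization `ψ` of the generic one over `T`.
  let χ : MvPolynomial (Fin N × Fin N) ℂ →ₐ[ℂ] Λ := MvPolynomial.aeval fun p => Z p.1 p.2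
  have hχZ : (Matrix.mvPolynomialX (Fin N) (Fin N) ℂ).map χ = Z := by
    ext i j
    simp [χ, Matrix.mvPolynomialX]
  have hχD : IsUnit (χ D) := by
    have h1 : χ D = (1 - skew Z).det := by
      rw [← hχZ]
      refine (AlgHom.map_det χ _).trans ?_
      rw [map_sub, map_one]
      exact congrArg (fun X : Matrix (Fin N) (Fin N) Λ => (1 - X).det)
        (skew_map (χ : MvPolynomial (Fin N × Fin N) ℂ →+* Λ) _).symm
    rw [h1]
    exact IsUnit.of_mul_eq_one_right d hd
  let ψ : T →ₐ[ℂ] Λ := IsLocalization.liftAlgHom (M := Submonoid.powers D) (f := χ) (by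
      rintro ⟨_, m, rfl⟩
      rw [map_pow]
      exact hχD.pow m)
  have hψZ : ZT.map ψ = Z := by
    rw [← hχZ]
    ext i j
    exact IsLocalization.lift_eq _ _
  have h1 : ψ dT * (1 - skew Z).det = 1 := by
    have h := cayley_den_map (ψ : T →+* Λ) hdT
    have hψZ' : ZT.map (ψ : T →+* Λ) = Z := hψZ
    rw [hψZ'] at h
    exact h
  have hψd : ψ dT = d := by
    calc ψ dT = d * (ψ dT * (1 - skew Z).det) := by linear_combination -ψ dT * hd
      _ = d := by rw [h1, mul_one]
  have h2 := congrArg ψ hx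
  rw [map_conjValue, map_zero] at h2
  rw [← h2, ← hψd]
  nth_rewrite 1 [← hψZ]
  exact congrArg _ (cayley_map (ψ : T →+* Λ) ZT dT)

/-- A function vanishing on the conjugacy class of `g` vanishes at every point `A` of `SO(N)` that
lies over `g`, has values in a nilpotent thickening of `ℂ` and is annihilated by a separable complex
polynomial. -/
theorem apply_eq_zero_of_thickening {g : SO N} {f : CoordRing N}
    (hf : ∀ x, IsConj g x → evalAt x f = 0) {Λ : Type*} [CommRing Λ] [Algebra ℂ Λ]
    (φ : CoordRing N →ₐ[ℂ] Λ) (π : Λ →ₐ[ℂ] ℂ) (hφ : π.comp φ = evalAt g) {k : ℕ}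
    (hπ : RingHom.ker π ^ k = ⊥) {p : ℂ[X]} (hp : p.Separable)
    (hpφ : ∀ i j, φ (aeval (coordMatrix N) p i j) = 0) : φ f = 0 := by
  obtain ⟨F, rfl⟩ := Ideal.Quotient.mk_surjective f
  set A := (coordMatrix N).map φ with hAdef
  have hA : adj A * A = 1 := by
    have := congrArg φ.mapMatrix (adj_coordMatrix_mul (N := N))
    rwa [map_mul, map_one] at this
  have hpA : aeval A p = 0 := by
    have h1 : aeval A p = φ.mapMatrix (aeval (coordMatrix N) p) :=
      Polynomial.aeval_algHom_apply φ.mapMatrix (coordMatrix N) p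
    rw [h1]
    ext i j
    exact hpφ i j
  have hAπ : A.map π = toMatrix g := by
    rw [← coordMatrix_map_evalAt, ← hφ, hAdef, Matrix.map_map]
    rfl
  obtain ⟨H, hH1, hH2, hH3⟩ := exists_orthogonal_intertwiner hπ hA hp hpA
  rw [hAπ] at hH2
  have hu : IsUnit (H + 1).det := by
    refine isUnit_det_of_map hπ ?_
    have h1 : (H + 1).map π = (2 : ℂ) • 1 := by
      change π.mapMatrix (H + 1) = _
      have h2 : π.mapMatrix H = 1 := hH3
      rw [map_add, map_one, h2, two_smul, one_add_one_eq_two]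
    rw [h1, det_smul, det_one, mul_one]
    exact pow_ne_zero _ two_ne_zero
  obtain ⟨Z, d, hd, rfl⟩ := exists_eq_cayley hH1 hu
  have hA' : A = cayley Z d * (toMatrix g).map (algebraMap ℂ Λ) * adj (cayley Z d) := by
    rw [← hH2, Matrix.mul_assoc, mul_eq_one_comm.1 hH1, Matrix.mul_one]
  have h := conjValue_cayley hf hd
  rwa [conjValue, ← hA', hAdef, ← algHom_apply_mk] at h

end CoordinateRing

/-! ### From nilpotent thickenings to the ideal -/

/-- Krull's intersection theorem, applied at all maximal ideals. -/
theorem mem_of_forall_mem_sup_pow {R : Type*} [CommRing R] [IsNoetherianRing R] {J : Ideal R}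
    {x : R} (h : ∀ M : Ideal R, M.IsMaximal → J ≤ M → ∀ k, x ∈ J ⊔ M ^ (k + 1)) : x ∈ J := by
  rw [← Ideal.Quotient.eq_zero_iff_mem]
  set y := Ideal.Quotient.mk J x with hy
  by_contra hne
  -- A maximal ideal over the annihilator of `y`. As `y` lies in all its powers, `(1 - r) y = 0` for
  -- one of its elements `r`, which contradicts its being proper.
  obtain ⟨M, hM, hle⟩ := Ideal.exists_le_maximal (Module.annihilator (R ⧸ J) (Ideal.span {y})) (by
    rw [Ne, Ideal.eq_top_iff_one, Module.mem_annihilator]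
    intro h1
    have := h1 ⟨y, Ideal.mem_span_singleton_self y⟩
    rw [one_smul] at this
    exact hne (congrArg Subtype.val this))
  have hmem : y ∈ (⨅ i : ℕ, M ^ i • ⊤ : Submodule (R ⧸ J) (R ⧸ J)) := by
    rw [Submodule.mem_iInf]
    intro i
    have hmax : (M.comap (Ideal.Quotient.mk J)).IsMaximal :=
      Ideal.comap_isMaximal_of_surjective _ Ideal.Quotient.mk_surjective
    have hJ : J ≤ M.comap (Ideal.Quotient.mk J) := by
      intro z hz
      rw [Ideal.mem_comap, Ideal.Quotient.eq_zero_iff_mem.2 hz]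
      exact M.zero_mem
    have := Ideal.mem_map_of_mem (Ideal.Quotient.mk J) (h _ hmax hJ i)
    rw [Ideal.map_sup, Ideal.map_quotient_self, bot_sup_eq, Ideal.map_pow,
      Ideal.map_comap_of_surjective _ Ideal.Quotient.mk_surjective] at this
    simpa using Ideal.pow_le_pow_right (Nat.le_succ i) this
  obtain ⟨r, hr⟩ := (Ideal.mem_iInf_smul_pow_eq_bot_iff M y).1 hmem
  have h1 : (1 - (r : R ⧸ J)) ∈ Module.annihilator (R ⧸ J) (Ideal.span {y}) := by
    rw [Module.mem_annihilator]
    rintro ⟨z, hz⟩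
    obtain ⟨c, rfl⟩ := Ideal.mem_span_singleton'.1 hz
    apply Subtype.ext
    have : (r : R ⧸ J) * y = y := hr
    change (1 - (r : R ⧸ J)) * (c * y) = 0
    linear_combination -c * this
  exact hM.ne_top ((Ideal.eq_top_iff_one M).2 (by simpa using M.add_mem (hle h1) r.2))

/-- If an ideal `I` lies between the kernel of a `K`-point `e` of `R` and a power of that kernel,
then `R / I` is a nilpotent thickening of `K`. -/
theorem exists_thickening {K : Type*} {R : Type} [CommRing K] [CommRing R] [Algebra K R]
    (e : R →ₐ[K] K) {I : Ideal R} (hI : I ≤ RingHom.ker e) {k : ℕ} (hk : RingHom.ker e ^ k ≤ I) :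
    ∃ (Λ : Type) (_ : CommRing Λ) (_ : Algebra K Λ) (φ : R →ₐ[K] Λ) (π : Λ →ₐ[K] K),
      π.comp φ = e ∧ RingHom.ker π ^ k = ⊥ ∧ ∀ x, φ x = 0 ↔ x ∈ I := by
  refine ⟨R ⧸ I, inferInstance, inferInstance, Ideal.Quotient.mkₐ K I,
    Ideal.Quotient.liftₐ I e hI, Ideal.Quotient.liftₐ_comp _ _ _, ?_,
    fun x => Ideal.Quotient.eq_zero_iff_mem⟩
  have h1 : RingHom.ker (Ideal.Quotient.liftₐ I e hI) ≤
      (RingHom.ker e).map (Ideal.Quotient.mk I) := by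
    intro x hx
    obtain ⟨x, rfl⟩ := Ideal.Quotient.mk_surjective x
    exact Ideal.mem_map_of_mem _ hx
  rw [eq_bot_iff]
  refine (Ideal.pow_right_mono h1 k).trans ?_
  rw [← Ideal.map_pow, Ideal.map_le_iff_le_comap]
  intro y hy
  exact Ideal.Quotient.eq_zero_iff_mem.2 (hk hy)

/-- Infinitesimal rigidity: if modulo the ideal `J` the coordinate matrix is annihilated by a
separable polynomial, then `J` contains every function that vanishes on the conjugacy classes of the
zeros of `J`. -/
theorem mem_of_vanishes {N : ℕ} {J : Ideal (CoordRing N)} {p : ℂ[X]} (hp : p.Separable)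
    (hpJ : ∀ i j, aeval (coordMatrix N) p i j ∈ J) {f : CoordRing N}
    (hf : ∀ g : SO N, J ≤ RingHom.ker (evalAt g) → ∀ x, IsConj g x → evalAt x f = 0) : f ∈ J := by
  have : IsNoetherianRing (CoordRing N) := inferInstance
  apply mem_of_forall_mem_sup_pow
  intro M hM hJM k
  obtain ⟨g, rfl⟩ := eq_ker_evalAt_of_isMaximal M
  obtain ⟨Λ, _, _, φ, π, hcomp, hker, hφ⟩ := exists_thickening (evalAt g)
    (sup_le hJM (Ideal.pow_le_self (Nat.succ_ne_zero k))) le_sup_right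
  exact (hφ f).1 (apply_eq_zero_of_thickening (hf g hJM) φ π hcomp hker hp
    fun i j => (hφ _).2 (Ideal.mem_sup_left (hpJ i j)))

/-! ### Power sums, diagonalization and square roots of complex matrices -/

theorem exists_perm_of_map_eq {α β : Type*} [Fintype α] [DecidableEq α] [DecidableEq β]
    {d e : α → β} (h : Multiset.map d Finset.univ.val = Multiset.map e Finset.univ.val) :
    ∃ σ : Equiv.Perm α, e ∘ σ = d := by
  have hcard (b : β) : Fintype.card {a // d a = b} = Fintype.card {a // e a = b} := by
    have := congrArg (Multiset.count b) h
    rw [Multiset.count_map, Multiset.count_map] at this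
    rw [Fintype.card_subtype, Fintype.card_subtype]
    simpa [Finset.card, eq_comm] using this
  refine ⟨Equiv.ofFiberEquiv fun b => Fintype.equivOfCardEq (hcard b), ?_⟩
  funext a
  exact Equiv.ofFiberEquiv_map _ a

/-- In characteristic zero the first `card α` power sums determine a family indexed by `α` up to
permutation. -/
theorem exists_perm_of_psum_eq {α K : Type*} [Fintype α] [DecidableEq α] [Field K] [CharZero K]
    {d e : α → K} (h : ∀ k, 1 ≤ k → k ≤ Fintype.card α → ∑ a, d a ^ k = ∑ a, e a ^ k) :
    ∃ σ : Equiv.Perm α, e ∘ σ = d := by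
  classical
  have hE (k : ℕ) (hk : k ≤ Fintype.card α) :
      MvPolynomial.aeval d (MvPolynomial.esymm α K k) =
        MvPolynomial.aeval e (MvPolynomial.esymm α K k) := by
    induction k using Nat.strong_induction_on with
    | _ k ih =>
    rcases Nat.eq_zero_or_pos k with rfl | hpos
    · simp
    have h1 (c : α → K) := congrArg (MvPolynomial.aeval c) (MvPolynomial.mul_esymm_eq_sum α K k)
    simp only [map_mul, map_sum, map_natCast, map_pow, map_neg, map_one] at h1
    have hk0 : (k : K) ≠ 0 := Nat.cast_ne_zero.2 hpos.ne'
    apply mul_left_cancel₀ hk0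
    rw [h1, h1]
    congr 1
    refine Finset.sum_congr rfl fun a ha => ?_
    rw [Finset.mem_filter, Finset.HasAntidiagonal.mem_antidiagonal] at ha
    rw [ih a.1 ha.2 (ha.2.le.trans hk)]
    congr 1
    simpa [MvPolynomial.psum] using h a.2 (by omega) (by omega)
  have hm (c : α → K) :
      (Multiset.map (fun t => X - C t) (Multiset.map c Finset.univ.val)).prod.roots =
        Multiset.map c Finset.univ.val := Polynomial.roots_multiset_prod_X_sub_C _
  apply exists_perm_of_map_eq
  rw [← hm d, ← hm e, Multiset.prod_X_sub_X_eq_sum_esymm, Multiset.prod_X_sub_X_eq_sum_esymm]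
  simp only [Multiset.card_map]
  congr 1
  refine Finset.sum_congr rfl fun k hk => ?_
  have := hE k (by simpa [Nat.lt_succ_iff] using hk)
  rw [MvPolynomial.aeval_esymm_eq_multiset_esymm,
    MvPolynomial.aeval_esymm_eq_multiset_esymm] at this
  rw [this]

/-- A complex matrix annihilated by a squarefree polynomial is diagonalizable. -/
theorem exists_eigenbasis {N : ℕ} {g : Matrix (Fin N) (Fin N) ℂ} {p : ℂ[X]} (hp : Squarefree p)
    (hpg : aeval g p = 0) :
    ∃ (h : Matrix (Fin N) (Fin N) ℂ) (d : Fin N → ℂ), IsUnit h ∧ g * h = h * diagonal d := by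
  let f : Module.End ℂ (Fin N → ℂ) := toLinAlgEquiv' g
  have hpf : aeval f p = 0 := by
    have : aeval f p = toLinAlgEquiv' (aeval g p) :=
      Polynomial.aeval_algHom_apply (toLinAlgEquiv'.toAlgHom) g p
    rw [this, hpg, map_zero]
  have hs : f.IsSemisimple := Module.End.isSemisimple_of_squarefree_aeval_eq_zero hp hpf
  have htop : ⨆ μ, f.eigenspace μ = ⊤ :=
    hs.iSup_maxGenEigenspace_eq_top_iff.1 (Module.End.iSup_maxGenEigenspace_eq_top f)
  have hint := DirectSum.isInternal_submodule_of_iSupIndep_of_iSup_eq_top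
    f.eigenspaces_iSupIndep htop
  let b := hint.collectedBasis fun μ => Module.Free.chooseBasis ℂ (f.eigenspace μ)
  let e := b.indexEquiv (Pi.basisFun ℂ (Fin N))
  let b' := b.reindex e
  have hb (j : Fin N) : f (b' j) = (e.symm j).1 • b' j := by
    rw [← Module.End.mem_eigenspace_iff, Module.Basis.reindex_apply]
    exact hint.collectedBasis_mem _ _
  refine ⟨(Pi.basisFun ℂ (Fin N)).toMatrix b', fun j => (e.symm j).1, ?_, ?_⟩
  · have := (Pi.basisFun ℂ (Fin N)).invertibleToMatrix b'
    exact isUnit_of_invertible _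
  · ext i j
    rw [mul_diagonal]
    have := congrFun (hb j) i
    rw [Pi.smul_apply, smul_eq_mul, mul_comm] at this
    exact this

/-- An invertible complex matrix has an inverse square root that is a polynomial in it: the
interpolation polynomial for the inverse square roots of the eigenvalues is an approximate one. -/
theorem exists_aeval_sq_mul_eq_one_of_isUnit {N : ℕ} {q : Matrix (Fin N) (Fin N) ℂ}
    (hq : IsUnit q) : ∃ r : ℂ[X], aeval q r ^ 2 * q = 1 := by
  classical
  have hq0 (a : ℂ) (ha : q.charpoly.IsRoot a) : a ≠ 0 := by
    rintro rfl
    have h1 : q.charpoly.eval 0 = (-q).det := by simp [eval_charpoly]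
    rw [IsRoot, h1, det_neg] at ha
    have := ((isUnit_iff_isUnit_det q).1 hq).ne_zero
    simp_all
  choose s hs using fun a : ℂ => IsAlgClosed.exists_pow_nat_eq a⁻¹ (n := 2) two_pos
  let r₀ := Lagrange.interpolate q.charpoly.roots.toFinset id s
  have hne : q.charpoly ≠ 0 := q.charpoly_monic.ne_zero
  have hr₀ (a : ℂ) (ha : q.charpoly.IsRoot a) : (r₀ ^ 2 * X - 1).eval a = 0 := by
    have h1 : r₀.eval a = s a :=
      Lagrange.eval_interpolate_at_node s (Set.injOn_id _) (by simpa [hne] using ha)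
    simp [h1, hs, inv_mul_cancel₀ (hq0 a ha)]
  have hdvd : q.charpoly ∣ (r₀ ^ 2 * X - 1) ^ q.charpoly.roots.card := by
    conv_lhs => rw [(IsAlgClosed.splits q.charpoly).eq_prod_roots_of_monic q.charpoly_monic]
    rw [← Multiset.prod_replicate, ← Multiset.map_const']
    refine Multiset.prod_dvd_prod_of_dvd _ _ fun a ha => ?_
    rw [dvd_iff_isRoot]
    exact hr₀ a (isRoot_of_mem_roots ha)
  obtain ⟨r, hr, -⟩ := exists_aeval_sq_mul_eq_one q r₀ ⟨q.charpoly.roots.card, by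
    obtain ⟨c, hc⟩ := hdvd
    have := congrArg (aeval q) hc
    rw [map_mul, aeval_self_charpoly, zero_mul] at this
    simpa using this⟩
  exact ⟨r, hr⟩

/-! ### The minimal polynomial and the diagonal entries of the base point -/

section DiagonalEntries

variable {ℓ : ℕ} (n : Fin ℓ → ℕ) (μ : Fin ℓ → ℂˣ) (P : ℕ) {N : ℕ}

/-- The roots of the polynomial `minPoly μ`. -/
def minPolyRoot (μ : Fin ℓ → ℂˣ) : (Fin ℓ ⊕ Bool) ⊕ Fin ℓ → ℂˣ :=
  Sum.elim (Sum.elim μ fun b => bif b then -1 else 1) fun i => (μ i)⁻¹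

theorem minPoly_eq_prod : minPoly μ = ∏ i, (X - C (minPolyRoot μ i : ℂ)) := by
  simp [minPoly, minPolyRoot, Fintype.prod_sum_type, mul_assoc]

theorem separable_minPoly {μ : Fin ℓ → ℂˣ} (hμ : ∀ i j, i < j → μ i ≠ μ j ∧ μ i ≠ (μ j)⁻¹)
    (hμ1 : ∀ i, μ i ^ 2 ≠ 1) : (minPoly μ).Separable := by
  have hinj (i j : Fin ℓ) (h : μ i = μ j) : i = j := by
    by_contra hij
    rcases lt_or_gt_of_ne hij with hlt | hlt
    · exact (hμ i j hlt).1 h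
    · exact (hμ j i hlt).1 h.symm
  have hinv (i j : Fin ℓ) : μ i ≠ (μ j)⁻¹ := by
    intro h
    rcases lt_trichotomy i j with hlt | rfl | hlt
    · exact (hμ i j hlt).2 h
    · exact hμ1 i (by rw [sq]; exact eq_inv_iff_mul_eq_one.1 h)
    · exact (hμ j i hlt).2 (by rw [h, inv_inv])
  have h1 (i : Fin ℓ) : μ i ≠ 1 := fun h => hμ1 i (by rw [h, one_pow])
  have h2 (i : Fin ℓ) : μ i ≠ -1 := fun h => hμ1 i (by rw [h, neg_one_sq])
  have h3 : (-1 : ℂˣ) ≠ 1 := by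
    intro h
    have := congrArg Units.val h
    norm_num at this
  have hI : (-1 : ℂˣ)⁻¹ = -1 := by simp
  rw [minPoly_eq_prod, separable_prod_X_sub_C_iff]
  refine Units.val_injective.comp ?_
  rintro ((i | _ | _) | i) ((j | _ | _) | j) h <;>
    simp only [minPolyRoot, Sum.elim_inl, Sum.elim_inr, cond_true, cond_false, _root_.inv_inj] at h
  · rw [hinj i j h]
  · exact absurd h (h1 i)
  · exact absurd h (h2 i)
  · exact absurd h (hinv i j)
  · exact absurd h.symm (h1 j)
  · rfl
  · exact absurd h.symm h3
  · exact absurd (inv_eq_one.1 h.symm) (h1 j)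
  · exact absurd h.symm (h2 j)
  · exact absurd h h3
  · rfl
  · exact absurd (by rw [← inv_inv (μ j), ← h, hI]) (h2 j)
  · exact absurd h.symm (hinv j i)
  · exact absurd (inv_eq_one.1 h) (h1 i)
  · exact absurd (by rw [← inv_inv (μ i), h, hI]) (h2 i)
  · rw [hinj i j h]

theorem sum_diagEntry {M : Type*} [AddCommMonoid M] (hN : N = 2 * ∑ i, n i + 2 + P) (f : ℂˣ → M) :
    ∑ k, f (diagEntry n μ P hN k) = ((diagEntries n μ P).map f).sum := by
  obtain rfl : N = (diagEntries n μ P).length := hN.trans (length_diagEntries n μ P).symm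
  simp [diagEntry, ← List.sum_ofFn]

theorem sum_diagEntry_pow (hN : N = 2 * ∑ i, n i + 2 + P) (k : ℕ) :
    ∑ j, (diagEntry n μ P hN j : ℂ) ^ k = traceValue n μ P k := by
  rw [sum_diagEntry n μ P hN fun u => (u : ℂ) ^ k]
  simp [diagEntries, leftEntries, traceValue, List.map_ofFn, List.sum_ofFn, Function.comp_def,
    List.map_flatten, List.sum_flatten, Finset.sum_add_distrib, mul_add, List.sum_reverse]
  ring

theorem eval_minPoly_diagEntry (hN : N = 2 * ∑ i, n i + 2 + P) (k : Fin N) :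
    (minPoly μ).eval (diagEntry n μ P hN k : ℂ) = 0 := by
  have hmem : diagEntry n μ P hN k ∈ diagEntries n μ P := List.get_mem _ _
  have hroot : ∃ i, minPolyRoot μ i = diagEntry n μ P hN k := by
    generalize diagEntry n μ P hN k = u at hmem
    simp only [diagEntries, leftEntries, List.mem_append, List.mem_flatten, List.mem_ofFn,
      List.mem_reverse, List.mem_map, List.mem_singleton, List.mem_replicate] at hmem
    rcases hmem with (((⟨_, ⟨i, rfl⟩, hu⟩ | rfl) | ⟨-, rfl⟩) | rfl) | ⟨v, ⟨_, ⟨i, rfl⟩, hv⟩, rfl⟩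
    · exact ⟨.inl (.inl i), (List.eq_of_mem_replicate hu).symm⟩
    · exact ⟨.inl (.inr true), rfl⟩
    · exact ⟨.inl (.inr false), rfl⟩
    · exact ⟨.inl (.inr true), rfl⟩
    · exact ⟨.inr i, by rw [List.eq_of_mem_replicate hv]; rfl⟩
  obtain ⟨i, hi⟩ := hroot
  rw [minPoly_eq_prod, eval_prod]
  exact Finset.prod_eq_zero (Finset.mem_univ i) (by simp [hi])

/-- The entry `-1` occurs at two positions that are exchanged by the reversal. -/
theorem exists_diagEntry_eq_neg_one (hN : N = 2 * ∑ i, n i + 2 + P) :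
    ∃ a : Fin N, a ≠ a.rev ∧ diagEntry n μ P hN a = -1 ∧ diagEntry n μ P hN a.rev = -1 := by
  let a : Fin N := ⟨∑ i, n i, by omega⟩
  have ha : diagEntry n μ P hN a = -1 := by
    have hl : (leftEntries n μ).length = ∑ i, n i := by
      simp [leftEntries, List.map_ofFn, List.sum_ofFn, Function.comp_def]
    have hlt : ∑ i, n i < (diagEntries n μ P).length := by
      rw [length_diagEntries]
      omega
    change (diagEntries n μ P)[∑ i, n i] = -1
    simp [diagEntries, ← hl]
  refine ⟨a, ?_, ha, ?_⟩
  · intro h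
    have := congrArg Fin.val h
    simp only [a, Fin.val_rev] at this
    omega
  · rw [diagEntry_rev, ha]
    simp

end DiagonalEntries

/-! ### The zeros of the relations -/

section ConjugacyClass

variable {N : ℕ}

theorem aeval_diagonal (d : Fin N → ℂ) (p : ℂ[X]) :
    aeval (diagonal d) p = diagonal fun i => p.eval (d i) := by
  have h : diagonal d = diagonalAlgHom ℂ d := rfl
  rw [h, aeval_algHom_apply, diagonalAlgHom_apply]
  congr 1
  ext i
  rw [← Polynomial.coe_aeval_eq_eval]
  exact (Polynomial.aeval_algHom_apply (Pi.evalAlgHom ℂ (fun _ : Fin N => ℂ) i) d p).symm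

theorem trace_pow_of_mul_eq {g h : Matrix (Fin N) (Fin N) ℂ} {d : Fin N → ℂ} (hu : IsUnit h)
    (hgh : g * h = h * diagonal d) (k : ℕ) : (g ^ k).trace = ∑ i, d i ^ k := by
  have h1 : g ^ k * h = h * diagonal d ^ k :=
    (SemiconjBy.pow_right (show SemiconjBy h (diagonal d) g from hgh.symm) k).eq.symm
  obtain ⟨u, rfl⟩ := hu
  have h2 : g ^ k = u.val * diagonal d ^ k * u⁻¹.val := by
    rw [← h1, mul_assoc, Units.mul_inv, mul_one]
  rw [h2, trace_units_conj, diagonal_pow, trace_diagonal]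
  rfl

/-- The transposition of two positions exchanged by the reversal is an orthogonal matrix of
determinant `-1`. -/
theorem swap_orthogonal {a : Fin N} (ha : a ≠ a.rev) :
    adj ((Equiv.swap a a.rev).permMatrix ℂ) * (Equiv.swap a a.rev).permMatrix ℂ = 1 ∧
      ((Equiv.swap a a.rev).permMatrix ℂ).det = -1 := by
  set σ := Equiv.swap a a.rev with hσ
  have hrev (i : Fin N) : σ i.rev = (σ i).rev := by
    rw [hσ, Equiv.swap_apply_def, Equiv.swap_apply_def]
    split_ifs <;> simp_all [Fin.rev_eq_iff]
  have hadj : adj (σ.permMatrix ℂ) = σ.permMatrix ℂ := by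
    ext i j
    have : σ j.rev = i.rev ↔ σ i = j := by
      rw [hrev, Fin.rev_inj, hσ, Equiv.swap_apply_eq_iff, eq_comm]
    simp [adj_apply, Equiv.Perm.permMatrix, PEquiv.toMatrix_apply, this]
  constructor
  · rw [hadj, ← Matrix.permMatrix_mul, hσ, Equiv.swap_mul_self, Matrix.permMatrix_one]
  · rw [det_permutation, hσ, Equiv.Perm.sign_swap ha]
    simp

theorem permMatrix_mul_diagonal_comm {σ : Equiv.Perm (Fin N)} {e : Fin N → ℂ}
    (h : ∀ i, e (σ i) = e i) : σ.permMatrix ℂ * diagonal e = diagonal e * σ.permMatrix ℂ := by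
  ext i j
  rw [mul_diagonal, diagonal_mul]
  by_cases hij : σ i = j
  · rw [← hij, h, mul_comm]
  · simp [Equiv.Perm.permMatrix, PEquiv.toMatrix_apply, hij]

/-- An element of `SO(N)` that is annihilated by a separable polynomial and has the same power
traces as a diagonal element `o` is conjugate to `o` under `SO(N)`, provided that a pair of
positions exchanged by the reversal carries equal entries of `o`: exchanging them is an orthogonal symmetry of
`o` of determinant `-1`. -/
theorem isConj_diagonal {o g : SO N} {e : Fin N → ℂ} (ho : toMatrix o = diagonal e) {a : Fin N}
    (ha : a ≠ a.rev) (hae : e a.rev = e a) {p : ℂ[X]} (hp : p.Separable)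
    (hpg : aeval (toMatrix g) p = 0)
    (htr : ∀ k, 1 ≤ k → k ≤ N → (toMatrix g ^ k).trace = ∑ i, e i ^ k) : IsConj o g := by
  obtain ⟨h₀, d, hu₀, hd⟩ := exists_eigenbasis hp.squarefree hpg
  obtain ⟨σ, rfl⟩ : ∃ σ : Equiv.Perm (Fin N), e ∘ σ = d :=
    exists_perm_of_psum_eq fun k h1 hk => by
      rw [← trace_pow_of_mul_eq hu₀ hd, htr k h1 (by simpa using hk)]
  -- Permuting the eigenvectors makes the eigenvalues appear in the order of `e`.
  let h := h₀.submatrix id σ.symm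
  have hgh : toMatrix g * h = h * toMatrix o := by
    ext i j
    have := congrFun (congrFun hd i) (σ.symm j)
    rw [mul_diagonal, Function.comp_apply, Equiv.apply_symm_apply] at this
    rw [ho, mul_diagonal]
    exact this
  have hu : IsUnit h := by
    rw [isUnit_iff_isUnit_det]
    have : h.det = Equiv.Perm.sign σ.symm * h₀.det := det_permute' σ.symm h₀
    rw [this]
    refine IsUnit.mul ?_ ((isUnit_iff_isUnit_det _).1 hu₀)
    exact (Units.isUnit _).map (Int.castRingHom ℂ)
  have huq : IsUnit (adj h * h) := by
    rw [isUnit_iff_isUnit_det, det_mul, det_adj]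
    exact ((isUnit_iff_isUnit_det _).1 hu).mul ((isUnit_iff_isUnit_det _).1 hu)
  obtain ⟨r, hr⟩ := exists_aeval_sq_mul_eq_one_of_isUnit huq
  obtain ⟨hC1, hC2⟩ := polar_intertwiner (adj_mul_toMatrix g) (adj_mul_toMatrix o) hgh hr
  generalize h * aeval (adj h * h) r = Q at hC1 hC2
  have hdet : Q.det = 1 ∨ Q.det = -1 := by
    have := congrArg det hC1
    rw [det_mul, det_adj, det_one] at this
    exact mul_self_eq_one_iff.1 this
  rcases hdet with hdet | hdet
  · exact isConj_of_mul_eq Q hC1 hdet hC2.symm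
  · obtain ⟨hW1, hW2⟩ := swap_orthogonal ha
    have hW3 : (Equiv.swap a a.rev).permMatrix ℂ * toMatrix o =
        toMatrix o * (Equiv.swap a a.rev).permMatrix ℂ := by
      rw [ho]
      apply permMatrix_mul_diagonal_comm
      intro i
      rw [Equiv.swap_apply_def]
      split_ifs with h1 h2
      · rw [h1, hae]
      · rw [h2, hae]
      · rfl
    generalize (Equiv.swap a a.rev).permMatrix ℂ = W at hW1 hW2 hW3
    refine isConj_of_mul_eq (Q * W) ?_ ?_ ?_
    · rw [adj_mul, mul_assoc, ← mul_assoc _ Q, hC1, one_mul, hW1]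
    · rw [det_mul, hdet, hW2]; norm_num
    · rw [mul_assoc, hW3, ← mul_assoc, ← mul_assoc, hC2]

theorem evalAt_aeval_coordMatrix (g : SO N) (p : ℂ[X]) (i j : Fin N) :
    evalAt g (aeval (coordMatrix N) p i j) = aeval (toMatrix g) p i j := by
  rw [← coordMatrix_map_evalAt]
  have := Polynomial.aeval_algHom_apply (evalAt g).mapMatrix (coordMatrix N) p
  exact (congrFun (congrFun this i) j).symm

theorem evalAt_trace_pow (g : SO N) (k : ℕ) :
    evalAt g (coordMatrix N ^ k).trace = (toMatrix g ^ k).trace := by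
  rw [← coordMatrix_map_evalAt, AddMonoidHom.map_trace]
  exact congrArg trace (map_pow (evalAt g).mapMatrix (coordMatrix N) k)

theorem mem_zeroLocus_iff {ℓ : ℕ} {n : Fin ℓ → ℕ} {μ : Fin ℓ → ℂˣ} {P : ℕ} {g : SO N} :
    g ∈ zeroLocus (minPolyRelations μ N ∪ traceRelations n μ P N) ↔
      aeval (toMatrix g) (minPoly μ) = 0 ∧
        ∀ k, 1 ≤ k → k ≤ N → (toMatrix g ^ k).trace = traceValue n μ P k := by
  constructor
  · intro h
    refine ⟨?_, fun k h1 hk => ?_⟩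
    · ext i j
      rw [← evalAt_aeval_coordMatrix]
      exact h _ (Or.inl ⟨i, j, rfl⟩)
    · have := h _ (Or.inr ⟨k, h1, hk, rfl⟩)
      rw [map_sub, evalAt_trace_pow, AlgHom.commutes] at this
      exact sub_eq_zero.1 this
  · rintro ⟨h1, h2⟩ f (⟨i, j, rfl⟩ | ⟨k, hk1, hk, rfl⟩)
    · rw [evalAt_aeval_coordMatrix, h1]
      rfl
    · rw [map_sub, evalAt_trace_pow, AlgHom.commutes, h2 k hk1 hk]
      exact sub_self _

theorem zeroLocus_eq_borderlineClass {ℓ : ℕ} {n : Fin ℓ → ℕ} {μ : Fin ℓ → ℂˣ} {P : ℕ}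
    (hN : N = 2 * ∑ i, n i + 2 + P) (hp : (minPoly μ).Separable) :
    zeroLocus (minPolyRelations μ N ∪ traceRelations n μ P N) = borderlineClass n μ P hN := by
  have ho : toMatrix (basePoint n μ P hN) = diagonal fun k => (diagEntry n μ P hN k : ℂ) := rfl
  ext g
  rw [mem_zeroLocus_iff]
  constructor
  · rintro ⟨h1, h2⟩
    obtain ⟨a, ha, ha1, ha2⟩ := exists_diagEntry_eq_neg_one n μ P hN
    exact isConj_diagonal ho ha (by rw [ha1, ha2]) hp h1 fun k hk1 hk => by
      rw [h2 k hk1 hk, sum_diagEntry_pow]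
  · intro hg
    obtain ⟨c, hc⟩ := isConj_iff.1 hg
    have hu : IsUnit (toMatrix c) := by
      rw [isUnit_iff_isUnit_det, det_toMatrix]
      exact isUnit_one
    have hgc : toMatrix g * toMatrix c = toMatrix c * toMatrix (basePoint n μ P hN) := by
      rw [← toMatrix_mul, ← toMatrix_mul, ← hc, inv_mul_cancel_right]
    constructor
    · have h1 : aeval (toMatrix (basePoint n μ P hN)) (minPoly μ) = 0 := by
        rw [ho, aeval_diagonal]
        simp [eval_minPoly_diagEntry]
      have h2 : aeval (toMatrix g) (minPoly μ) * toMatrix c = toMatrix c *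
          aeval (toMatrix (basePoint n μ P hN)) (minPoly μ) := by
        exact (semiconjBy_aeval (show SemiconjBy _ _ _ from hgc.symm) (minPoly μ)).eq.symm
      rw [h1, mul_zero] at h2
      exact hu.mul_left_eq_zero.1 h2
    · intro k _ _
      rw [trace_pow_of_mul_eq hu (hgc.trans (by rw [ho])), sum_diagEntry_pow]

end ConjugacyClass

end BorderlineSO

theorem mainTheorem6 (ℓ : ℕ) (n : Fin ℓ → ℕ) (μ : Fin ℓ → ℂˣ) (P N : ℕ) (hP : 1 ≤ P)
    (hN : N = 2 * ∑ i, n i + 2 + P)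
    (hμ : ∀ i j, i < j → μ i ≠ μ j ∧ μ i ≠ (μ j)⁻¹)
    (hμ1 : ∀ i, μ i ^ 2 ≠ 1) :
    Ideal.span (BorderlineSO.minPolyRelations μ N ∪ BorderlineSO.traceRelations n μ P N) =
        BorderlineSO.vanishingIdeal (BorderlineSO.borderlineClass n μ P hN) ∧
      BorderlineSO.zeroLocus
          (BorderlineSO.minPolyRelations μ N ∪ BorderlineSO.traceRelations n μ P N) =
        BorderlineSO.borderlineClass n μ P hN := by
  have hp : (BorderlineSO.minPoly μ).Separable := BorderlineSO.separable_minPoly hμ hμ1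
  have hzero := BorderlineSO.zeroLocus_eq_borderlineClass (n := n) hN hp
  refine ⟨le_antisymm ?_ ?_, hzero⟩
  · rw [Ideal.span_le]
    intro f hf
    rw [SetLike.mem_coe, BorderlineSO.mem_vanishingIdeal_iff]
    intro g hg
    rw [← hzero] at hg
    exact hg f hf
  · intro f hf
    rw [BorderlineSO.mem_vanishingIdeal_iff] at hf
    refine BorderlineSO.mem_of_vanishes hp (fun i j => Ideal.subset_span (Or.inl ⟨i, j, rfl⟩)) ?_
    intro g hg x hx
    have hg' : g ∈ BorderlineSO.borderlineClass n μ P hN := by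
      rw [← hzero]
      exact fun f' hf' => hg (Ideal.subset_span hf')
    exact hf x (hg'.trans hx)
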